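/- Let $\mathcal A$ and $\mathcal B$ be unital operator algebras (norm-closed unital, possibly non-selfadjoint, algebras of Hilbert space operators), with maximal C*-algebras $\mathcal C=C^*_{max}(\mathcal A)\supseteq\mathcal A$ and $\mathcal D=C^*_{max}(\mathcal B)\supseteq\mathcal B$: $\mathcal A$ generates $\mathcal C$ as a C*-algebra, every completely contractive homomorphism from $\mathcal A$ into a C*-algebra extends to a $*$-homomorphism on $\mathcal C$, and similarly for $\mathcal B\subseteq\mathcal D$. An operator bimodule over two unital operator algebras is a unital bimodule with matrix norms that can be identified, completely isometrically, with a closed subspace of some $B(K_0,H_0)$ ($H_0,K_0$ Hilbert spaces) so that the left and right actions become multiplication by the operators of completely contractive representations on $H_0$ and $K_0$. Let $X$ be an $\mathcal A$-$\mathcal B$-operator bimodule, and let $\tilde X$ ($=\mathcal C\otimes_{h\mathcal A}X\otimes_{h\mathcal B}\mathcal D$), with $i:X\to\tilde X$, be its bi-dilation: $\tilde X$ is a $\mathcal C$-$\mathcal D$-operator bimodule, $i$ is a completely contractive $\mathcal A$-$\mathcal B$-bimodule map, and every completely bounded $\mathcal A$-$\mathcal B$-bimodule map $T$ from $X$ into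 a $\mathcal C$-$\mathcal D$-operator bimodule $V$ is of the form $T=\tilde T\circ i$ for a unique completely bounded $\mathcal C$-$\mathcal D$-bimodule map $\tilde T:\tilde X\to V$, and moreover $\|\tilde T\|_{cb}=\|T\|_{cb}$. A faithful CES (Christensen-Effros-Sinclair) representation of $(\mathcal C,\mathcal D,\tilde X)$ on Hilbert spaces $H',K'$ consists of faithful unital $*$-representations $\rho$ of $\mathcal C$ on $H'$ and $\sigma$ of $\mathcal D$ on $K'$ and a completely isometric linear map $j:\tilde X\to B(K',H')$ with $j(c\,\tilde x\,d)=\rho(c)j(\tilde x)\sigma(d)$. Suppressing $\rho,\sigma,j$ and $i$ from the notation, put $$\mathcal S=\left\{\begin{bmatrix}c&\tilde x\\ \tilde y^*&d\end{bmatrix}: c\in\mathcal C,\ d\in\mathcal D,\ \tilde x,\tilde y\in\tilde X\right\}\subseteq B(H'\oplus K'),\qquad \mathcal U(X)=\left\{\begin{bmatrix}a&x\\0&b\end{bmatrix}: a\in\mathcal A,\ b\in\mathcal B,\ x\in X\right\}\subseteq\mathcal S,$$ an operator system and a unital subalgebra of $B(H'\oplus K')$ (the upper linking algebra of $X$). (1)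 Let $\theta$ and $\pi$ be (possibly degenerate) $*$-representations of $\mathcal C$ and $\mathcal D$ on Hilbert spaces $H$ and $K$, and let $\Phi:\tilde X\to B(K,H)$ be a completely contractive linear map with $\Phi(c\,\tilde x\,d)=\theta(c)\Phi(\tilde x)\pi(d)$. Then, for every faithful CES representation, $$\Psi:\mathcal S\to B(H\oplus K),\qquad \begin{bmatrix}c&\tilde x\\ \tilde y^*&d\end{bmatrix}\mapsto\begin{bmatrix}\theta(c)&\Phi(\tilde x)\\ \Phi(\tilde y)^*&\pi(d)\end{bmatrix}$$ is a well-defined completely positive linear map. (2) $\mathcal S$ and $\mathcal U(X)$ do not depend on the faithful CES representation: given two such representations, with spaces $\mathcal S_1,\mathcal S_2$ and $\mathcal U_1(X),\mathcal U_2(X)$, the map $\mathcal S_1\to\mathcal S_2$ that sends the matrix in $\mathcal S_1$ with entries $c,\tilde x,\tilde y^*,d$ to the matrix in $\mathcal S_2$ with the same entries is a well-defined unital, $*$-preserving linear isomorphism which is a complete order isomorphism and completely isometric, and it restricts to a completely isometric algebra isomorphism from $\mathcal U_1(X)$ onto $\mathcal U_2(X)$. -/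

import Mathlib

universe u

noncomputable section

namespace BiDil

/-! ## Matrices of operators on Hilbert spaces -/

section Operators

variable {H K : Type*} [NormedAddCommGroup H] [InnerProductSpace ℂ H]
  [NormedAddCommGroup K] [InnerProductSpace ℂ K]

/-- The identification `M_n(B(K, H)) = B(Kⁿ, Hⁿ)` (Hilbert space direct sums): the operator
`(k_j)_j ↦ (∑ j, M i j k_j)_i`. -/
def matOp {n : ℕ} (M : Matrix (Fin n) (Fin n) (K →L[ℂ] H)) :
    PiLp 2 (fun _ : Fin n => K) →L[ℂ] PiLp 2 (fun _ : Fin n => H) :=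
  ((PiLp.continuousLinearEquiv 2 ℂ (fun _ : Fin n => H)).symm :
      (Fin n → H) →L[ℂ] PiLp 2 (fun _ : Fin n => H)) ∘L
    ContinuousLinearMap.pi (fun i => ∑ j, M i j ∘L PiLp.proj 2 (fun _ : Fin n => K) j)

theorem matOp_apply {n : ℕ} (M : Matrix (Fin n) (Fin n) (K →L[ℂ] H))
    (v : PiLp 2 (fun _ : Fin n => K)) (i : Fin n) :
    matOp M v i = ∑ j, M i j (v j) := by
  simp [matOp]

/-- The operator on `H ⊕ K` (Hilbert space direct sum) with the `2 × 2` operator matrix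
`[[a, b], [c, d]]`. -/
def block (a : H →L[ℂ] H) (b : K →L[ℂ] H) (c : H →L[ℂ] K) (d : K →L[ℂ] K) :
    WithLp 2 (H × K) →L[ℂ] WithLp 2 (H × K) :=
  ((WithLp.prodContinuousLinearEquiv 2 ℂ H K).symm : (H × K) →L[ℂ] WithLp 2 (H × K)) ∘L
    ((a.coprod b).prod (c.coprod d)) ∘L
    (WithLp.prodContinuousLinearEquiv 2 ℂ H K : WithLp 2 (H × K) →L[ℂ] (H × K))

theorem block_apply (a : H →L[ℂ] H) (b : K →L[ℂ] H) (c : H →L[ℂ] K) (d : K →L[ℂ] K)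
    (v : WithLp 2 (H × K)) :
    block a b c d v = WithLp.toLp 2 (a v.fst + b v.snd, c v.fst + d v.snd) := rfl

theorem block_add (a a' : H →L[ℂ] H) (b b' : K →L[ℂ] H) (c c' : H →L[ℂ] K)
    (d d' : K →L[ℂ] K) :
    block a b c d + block a' b' c' d' = block (a + a') (b + b') (c + c') (d + d') := by
  refine ContinuousLinearMap.ext fun v => WithLp.ofLp_injective 2 (Prod.ext ?_ ?_) <;>
    simp [block_apply] <;> abel

theorem block_zero : block (0 : H →L[ℂ] H) 0 0 (0 : K →L[ℂ] K) = 0 := by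
  refine ContinuousLinearMap.ext fun v => WithLp.ofLp_injective 2 (Prod.ext ?_ ?_) <;>
    simp [block_apply]

theorem block_smul (r : ℂ) (a : H →L[ℂ] H) (b : K →L[ℂ] H) (c : H →L[ℂ] K)
    (d : K →L[ℂ] K) :
    r • block a b c d = block (r • a) (r • b) (r • c) (r • d) := by
  refine ContinuousLinearMap.ext fun v => WithLp.ofLp_injective 2 (Prod.ext ?_ ?_) <;>
    simp [block_apply]

theorem block_mul (a a' : H →L[ℂ] H) (b b' : K →L[ℂ] H) (c c' : H →L[ℂ] K)
    (d d' : K →L[ℂ] K) :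
    block a b c d * block a' b' c' d' =
      block (a ∘L a' + b ∘L c') (a ∘L b' + b ∘L d') (c ∘L a' + d ∘L c') (c ∘L b' + d ∘L d') := by
  refine ContinuousLinearMap.ext fun v => WithLp.ofLp_injective 2 (Prod.ext ?_ ?_) <;>
    simp [block_apply] <;> abel

theorem block_one : block (1 : H →L[ℂ] H) 0 0 (1 : K →L[ℂ] K) = 1 := by
  refine ContinuousLinearMap.ext fun v => WithLp.ofLp_injective 2 (Prod.ext ?_ ?_) <;>
    simp [block_apply]

theorem block_star [CompleteSpace H] [CompleteSpace K] (a : H →L[ℂ] H) (b : K →L[ℂ] H)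
    (c : H →L[ℂ] K) (d : K →L[ℂ] K) :
    star (block a b c d) =
      block a.adjoint c.adjoint b.adjoint d.adjoint := by
  symm
  rw [ContinuousLinearMap.star_eq_adjoint, ContinuousLinearMap.eq_adjoint_iff]
  intro x y
  simp only [block_apply, WithLp.prod_inner_apply, inner_add_left, inner_add_right,
    ContinuousLinearMap.adjoint_inner_left, WithLp.ofLp_fst, WithLp.ofLp_snd]
  ring

end Operators

/-! ## Matrix norms, operator bimodules -/

/-- A family of functions on the square matrix spaces `M_n(X)`; all those used below are the
matrix norms of operator spaces. -/
abbrev MatNorm (X : Type*) := ∀ n : ℕ, Matrix (Fin n) (Fin n) X → ℝ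

/-- The matrix norms of `B(K, H)`. -/
def opNorms (K H : Type*) [NormedAddCommGroup H] [InnerProductSpace ℂ H]
    [NormedAddCommGroup K] [InnerProductSpace ℂ K] : MatNorm (K →L[ℂ] H) :=
  fun _ M => ‖matOp M‖

/-- The matrix norms of a C⋆-algebra `E`: `M_n(E)` carries its unique C⋆-norm. -/
def cstarNorms (E : Type*) [NonUnitalCStarAlgebra E] : MatNorm E :=
  fun _ M =>
    letI := CStarAlgebra.spectralOrder E
    letI := CStarAlgebra.spectralOrderedRing E
    ‖CStarMatrix.ofMatrix M‖

/-- The matrix norms that a subalgebra inherits from the C⋆-algebra containing it. -/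
def subNorms {C : Type*} [CStarAlgebra C] (A : Subalgebra ℂ C) : MatNorm A :=
  fun n M => cstarNorms C n (M.map Subtype.val)

/-- All amplifications of `T` are bounded by `r`. -/
def CBBound {X Y : Type*} (ν : MatNorm X) (μ : MatNorm Y) (T : X → Y) (r : ℝ) : Prop :=
  ∀ (n : ℕ) (M : Matrix (Fin n) (Fin n) X), μ n (M.map T) ≤ r * ν n M

/-- Completely bounded. -/
def IsCB {X Y : Type*} (ν : MatNorm X) (μ : MatNorm Y) (T : X → Y) : Prop :=
  ∃ r : ℝ, 0 ≤ r ∧ CBBound ν μ T r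

/-- The completely bounded norm (of a completely bounded map). -/
def cbNorm {X Y : Type*} (ν : MatNorm X) (μ : MatNorm Y) (T : X → Y) : ℝ :=
  sInf {r : ℝ | 0 ≤ r ∧ CBBound ν μ T r}

/-- Completely contractive. -/
def IsCC {X Y : Type*} (ν : MatNorm X) (μ : MatNorm Y) (T : X → Y) : Prop :=
  ∀ (n : ℕ) (M : Matrix (Fin n) (Fin n) X), μ n (M.map T) ≤ ν n M

/-- Completely isometric (for linear maps on operator spaces this includes injectivity). -/
def IsCI {X Y : Type*} (ν : MatNorm X) (μ : MatNorm Y) (T : X → Y) : Prop :=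
  ∀ (n : ℕ) (M : Matrix (Fin n) (Fin n) X), μ n (M.map T) = ν n M

/-- `T : X → Y` is a bimodule map, where `X` is a bimodule over `A`, `B`, where `Y` is a bimodule
over `C`, `D`, and where `A`, `B` act on `Y` through `f : A → C` and `g : B → D`. -/
structure IsBimoduleMap {A B C D X Y : Type*} [SMul A X] [SMul Bᵐᵒᵖ X] [SMul C Y] [SMul Dᵐᵒᵖ Y]
    (f : A → C) (g : B → D) (T : X → Y) : Prop where
  map_left : ∀ (a : A) (x : X), T (a • x) = f a • T x
  map_right : ∀ (b : B) (x : X), T (MulOpposite.op b • x) = MulOpposite.op (g b) • T x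

/-- `T : X → B(K, H)` is a bimodule map, where `A` acts on `H` through `θ` and `B` acts on `K`
through `π`. -/
structure IsOpBimoduleMap {A B X H K : Type*} [SMul A X] [SMul Bᵐᵒᵖ X]
    [NormedAddCommGroup H] [InnerProductSpace ℂ H] [NormedAddCommGroup K] [InnerProductSpace ℂ K]
    (θ : A → (H →L[ℂ] H)) (π : B → (K →L[ℂ] K)) (T : X → (K →L[ℂ] H)) : Prop where
  map_left : ∀ (a : A) (x : X), T (a • x) = θ a ∘L T x
  map_right : ∀ (b : B) (x : X), T (MulOpposite.op b • x) = T x ∘L π b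

/-- `X`, with its bimodule structure and its matrix norms `ν`, is an operator bimodule over the
unital operator algebras `A`, `B`: it may be identified, completely isometrically, with a
closed subspace of some `B(K, H)` in such a way that the module actions become the multiplication
by the operators of completely contractive representations of `A` on `H` and of `B` on `K`.
The module actions are nondegenerate because the identities act as identities. -/
def IsOperatorBimodule {A B X : Type u} [Ring A] [Algebra ℂ A] [Ring B] [Algebra ℂ B]
    [AddCommGroup X] [Module ℂ X] [Module A X] [Module Bᵐᵒᵖ X]
    (α : MatNorm A) (β : MatNorm B) (ν : MatNorm X) : Prop :=
  ∃ (H K : Type u) (_ : NormedAddCommGroup H) (_ : InnerProductSpace ℂ H) (_ : CompleteSpace H)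
    (_ : NormedAddCommGroup K) (_ : InnerProductSpace ℂ K) (_ : CompleteSpace K)
    (ρ : A →ₙₐ[ℂ] (H →L[ℂ] H)) (σ : B →ₙₐ[ℂ] (K →L[ℂ] K)) (j : X →ₗ[ℂ] (K →L[ℂ] H)),
    IsCC α (opNorms H H) ρ ∧ IsCC β (opNorms K K) σ ∧
    Function.Injective j ∧ IsCI ν (opNorms K H) j ∧ IsClosed (Set.range j) ∧ IsOpBimoduleMap ρ σ j

/-! ## Maximal C⋆-algebras and bi-dilations -/

/-- `A` is a closed unital subalgebra of the C⋆-algebra `C`, and `C` is the maximal C⋆-algebra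
generated by the operator algebra `A`. -/
structure IsMaximalCStarAlgebra {C : Type u} [CStarAlgebra C] (A : Subalgebra ℂ C) : Prop where
  isClosed : IsClosed (A : Set C)
  generates : (StarAlgebra.adjoin ℂ (A : Set C)).topologicalClosure = ⊤
  extend : ∀ (E : Type u) [NonUnitalCStarAlgebra E] (φ : A →ₙₐ[ℂ] E),
    IsCC (subNorms A) (cstarNorms E) φ →
    ∃ φ' : C →⋆ₙₐ[ℂ] E, ∀ a : A, φ' (a : C) = φ a

/-- `(Xt, i)` is the `C`-`D`-dilation (bi-dilation) of the operator bimodule `X` over `A ⊆ C` and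
`B ⊆ D`: the universal `C`-`D`-operator bimodule receiving a completely contractive
`A`-`B`-bimodule map from `X`. -/
structure IsBiDilation {C D X Xt : Type u} [CStarAlgebra C] [CStarAlgebra D]
    (A : Subalgebra ℂ C) (B : Subalgebra ℂ D)
    [AddCommGroup X] [Module ℂ X] [Module A X] [Module Bᵐᵒᵖ X]
    [AddCommGroup Xt] [Module ℂ Xt] [Module C Xt] [Module Dᵐᵒᵖ Xt]
    (ν : MatNorm X) (μ : MatNorm Xt) (i : X →ₗ[ℂ] Xt) : Prop where
  isOperatorBimodule : IsOperatorBimodule (cstarNorms C) (cstarNorms D) μ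
  isCC : IsCC ν μ i
  isBimoduleMap : IsBimoduleMap (Subtype.val : A → C) (Subtype.val : B → D) i
  extend : ∀ (V : Type u) [AddCommGroup V] [Module ℂ V] [Module C V] [Module Dᵐᵒᵖ V]
    (κ : MatNorm V), IsOperatorBimodule (cstarNorms C) (cstarNorms D) κ →
    ∀ T : X →ₗ[ℂ] V, IsCB ν κ T →
      IsBimoduleMap (Subtype.val : A → C) (Subtype.val : B → D) T →
      ∃ T' : Xt →ₗ[ℂ] V,
        (IsCB μ κ T' ∧ IsBimoduleMap (id : C → C) (id : D → D) T' ∧ T' ∘ₗ i = T) ∧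
        cbNorm μ κ T' = cbNorm ν κ T ∧
        ∀ T'' : Xt →ₗ[ℂ] V,
          IsCB μ κ T'' ∧ IsBimoduleMap (id : C → C) (id : D → D) T'' ∧ T'' ∘ₗ i = T → T'' = T'

/-! ## Faithful representations and the operator system -/

/-- A faithful Christensen–Effros–Sinclair representation of `C`, `D` and the operator bimodule
`Xt` on the Hilbert spaces `H`, `K`. -/
structure FaithfulCES (C D : Type*) {Xt : Type*} [CStarAlgebra C] [CStarAlgebra D]
    [AddCommGroup Xt] [Module ℂ Xt] [Module C Xt] [Module Dᵐᵒᵖ Xt] (μ : MatNorm Xt)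
    (H K : Type*) [NormedAddCommGroup H] [InnerProductSpace ℂ H] [CompleteSpace H]
    [NormedAddCommGroup K] [InnerProductSpace ℂ K] [CompleteSpace K] where
  left : C →⋆ₐ[ℂ] (H →L[ℂ] H)
  right : D →⋆ₐ[ℂ] (K →L[ℂ] K)
  corner : Xt →ₗ[ℂ] (K →L[ℂ] H)
  left_injective : Function.Injective left
  right_injective : Function.Injective right
  corner_isCI : IsCI μ (opNorms K H) corner
  corner_bimodule : IsOpBimoduleMap left right corner

namespace FaithfulCES

variable {C D Xt H K : Type*} [CStarAlgebra C] [CStarAlgebra D]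
  [AddCommGroup Xt] [Module ℂ Xt] [Module C Xt] [Module Dᵐᵒᵖ Xt] {μ : MatNorm Xt}
  [NormedAddCommGroup H] [InnerProductSpace ℂ H] [CompleteSpace H]
  [NormedAddCommGroup K] [InnerProductSpace ℂ K] [CompleteSpace K]

/-- The operator `[[c, x], [y⋆, d]]` on `H ⊕ K`. -/
def mat (R : FaithfulCES C D μ H K) (c : C) (x y : Xt) (d : D) :
    WithLp 2 (H × K) →L[ℂ] WithLp 2 (H × K) :=
  block (R.left c) (R.corner x) (R.corner y).adjoint (R.right d)

/-- The space `S` of all operators `[[c, x], [y⋆, d]]`. -/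
def system (R : FaithfulCES C D μ H K) :
    Submodule ℂ (WithLp 2 (H × K) →L[ℂ] WithLp 2 (H × K)) where
  carrier := {T | ∃ (c : C) (x y : Xt) (d : D), T = R.mat c x y d}
  zero_mem' := ⟨0, 0, 0, 0, by simp [mat, block_zero]⟩
  add_mem' := by
    rintro _ _ ⟨c, x, y, d, rfl⟩ ⟨c', x', y', d', rfl⟩
    exact ⟨c + c', x + x', y + y', d + d', by simp [mat, block_add]⟩
  smul_mem' := by
    rintro r _ ⟨c, x, y, d, rfl⟩
    exact ⟨r • c, r • x, (starRingEnd ℂ r) • y, r • d, by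
      simp only [mat, block_smul, map_smul, map_smulₛₗ, Complex.conj_conj]⟩

/-- The element `[[c, x], [y⋆, d]]` of `S`. -/
def elt (R : FaithfulCES C D μ H K) (c : C) (x y : Xt) (d : D) : R.system :=
  ⟨R.mat c x y d, c, x, y, d, rfl⟩

/-- `S` is an operator system: it contains the identity. -/
theorem one_mem_system (R : FaithfulCES C D μ H K) : 1 ∈ R.system :=
  ⟨1, 0, 0, 1, by simp [mat, block_one]⟩

/-- `S` is an operator system: it is selfadjoint. -/
theorem star_mem_system (R : FaithfulCES C D μ H K) {T} (hT : T ∈ R.system) :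
    star T ∈ R.system := by
  obtain ⟨c, x, y, d, rfl⟩ := hT
  exact ⟨star c, y, x, star d, by
    simp [mat, block_star, ← ContinuousLinearMap.star_eq_adjoint, map_star]⟩

/-- The upper linking operator algebra `U(X)`: the operators `[[a, x], [0, b]]` with `a ∈ A`,
`b ∈ B`, and `x ∈ X` (more precisely, in the image of `X` in `Xt`). -/
def upper {X : Type*} (R : FaithfulCES C D μ H K) (A : Subalgebra ℂ C) (B : Subalgebra ℂ D)
    [AddCommGroup X] [Module ℂ X] [Module A X] [Module Bᵐᵒᵖ X] (i : X →ₗ[ℂ] Xt)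
    (hi : IsBimoduleMap (Subtype.val : A → C) (Subtype.val : B → D) i) :
    Subalgebra ℂ (WithLp 2 (H × K) →L[ℂ] WithLp 2 (H × K)) where
  carrier := {T | ∃ (a : A) (x : X) (b : B), T = R.mat (a : C) (i x) 0 (b : D)}
  mul_mem' := by
    rintro _ _ ⟨a, x, b, rfl⟩ ⟨a', x', b', rfl⟩
    refine ⟨a * a', a • x' + MulOpposite.op b' • x, b * b', ?_⟩
    simp only [mat]
    rw [block_mul]
    simp [hi.map_left, hi.map_right, R.corner_bimodule.map_left,
      R.corner_bimodule.map_right, ContinuousLinearMap.mul_def]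
  add_mem' := by
    rintro _ _ ⟨a, x, b, rfl⟩ ⟨a', x', b', rfl⟩
    exact ⟨a + a', x + x', b + b', by simp [mat, block_add]⟩
  algebraMap_mem' := by
    intro r
    refine ⟨algebraMap ℂ A r, 0, algebraMap ℂ B r, ?_⟩
    rw [Algebra.algebraMap_eq_smul_one, ← block_one, block_smul]
    simp [mat, Algebra.algebraMap_eq_smul_one]

theorem upper_le_system {X : Type*} (R : FaithfulCES C D μ H K) (A : Subalgebra ℂ C)
    (B : Subalgebra ℂ D) [AddCommGroup X] [Module ℂ X] [Module A X] [Module Bᵐᵒᵖ X]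
    (i : X →ₗ[ℂ] Xt) (hi : IsBimoduleMap (Subtype.val : A → C) (Subtype.val : B → D) i)
    {T} (hT : T ∈ R.upper A B i hi) : T ∈ R.system := by
  obtain ⟨a, x, b, rfl⟩ := hT
  exact ⟨a, i x, 0, b, rfl⟩

end FaithfulCES

/-! ## Completely positive maps and isomorphisms of operator systems -/

/-- A linear map on a space `S` of operators on `N` with values in `B(N')` is completely positive:
each amplification `M_n(S) → M_n(B(N'))` maps positive operators on `Nⁿ` to positive operators. -/
def IsCompletelyPositive {N N' : Type*} [NormedAddCommGroup N] [InnerProductSpace ℂ N]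
    [NormedAddCommGroup N'] [InnerProductSpace ℂ N'] {S : Submodule ℂ (N →L[ℂ] N)}
    (Ψ : S →ₗ[ℂ] (N' →L[ℂ] N')) : Prop :=
  ∀ (n : ℕ) (M : Matrix (Fin n) (Fin n) S),
    (matOp (M.map (Subtype.val : S → (N →L[ℂ] N)))).IsPositive → (matOp (M.map Ψ)).IsPositive

/-- The matrix norms that a set of operators on `N` inherits from `B(N)`. -/
def inheritedNorms {N : Type*} [NormedAddCommGroup N] [InnerProductSpace ℂ N]
    (S : Set (N →L[ℂ] N)) : MatNorm S :=
  fun n M => opNorms N N n (M.map Subtype.val)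

/-- `e` is an isomorphism of operator systems: unital, selfadjoint, a complete order isomorphism,
and completely isometric. -/
structure IsOperatorSystemIso {N N' : Type*} [NormedAddCommGroup N] [InnerProductSpace ℂ N]
    [CompleteSpace N] [NormedAddCommGroup N'] [InnerProductSpace ℂ N'] [CompleteSpace N']
    {S : Submodule ℂ (N →L[ℂ] N)} {S' : Submodule ℂ (N' →L[ℂ] N')} (e : S ≃ₗ[ℂ] S') : Prop where
  map_one : ∀ s : S, (s : N →L[ℂ] N) = 1 → (e s : N' →L[ℂ] N') = 1
  map_star : ∀ s t : S, (t : N →L[ℂ] N) = star (s : N →L[ℂ] N) →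
    (e t : N' →L[ℂ] N') = star (e s : N' →L[ℂ] N')
  positive_iff : ∀ (n : ℕ) (M : Matrix (Fin n) (Fin n) S),
    (matOp (M.map fun s => (e s : N' →L[ℂ] N'))).IsPositive ↔
      (matOp (M.map fun s => (s : N →L[ℂ] N))).IsPositive
  isCI : IsCI (inheritedNorms (S : Set (N →L[ℂ] N))) (inheritedNorms (S' : Set (N' →L[ℂ] N'))) e

end BiDil

end

/-! After regrouping $(H\oplus K)^n$ as $H^n\oplus K^n$, positivity of a matrix over $\mathcal S$
says that the entries fit together selfadjointly and that
$\begin{bmatrix}P&Q\\Q^*&S\end{bmatrix}\ge0$ with $P\in M_n(\mathcal C)$, $Q\in M_n(\tilde X)$,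
$S\in M_n(\mathcal D)$ (`isPositive_matOp_block`). Replace $P,S$ by $P+\varepsilon=E^2$ and
$S+\varepsilon=E'^2$, with $E,E'$ selfadjoint and invertible over $\mathcal C$ and $\mathcal D$.
Conjugating by the inverses $F,F'$ turns positivity into $\|FQF'\|\le1$. This is a matrix norm in
$\tilde X$, so a completely contractive $\Phi$ preserves the bound. Conjugating back by
$\theta(E),\pi(E')$ and letting $\varepsilon\to0$ gives positivity of the image. This is
`blockPos_map`, the heart of (1).

For (2), apply (1) with $(\theta,\pi,\Phi)$ taken from the other faithful representation, in both
directions. The two completely positive maps are mutually inverse, unital and $*$-preserving, hence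
completely contractive by the $2\times2$ matrix trick (`IsCompletelyPositive.norm_matOp_le`), hence
completely isometric. Products of upper triangular elements involve only the products and module
actions, so the same map is multiplicative on $\mathcal U(X)$. -/

namespace BiDil

open scoped ComplexOrder InnerProductSpace

/-! ### Calculus of operator matrices acting on $H^n$. -/

section MatOp

variable {H K : Type*} [NormedAddCommGroup H] [InnerProductSpace ℂ H]
  [NormedAddCommGroup K] [InnerProductSpace ℂ K]
  {n : ℕ}

theorem matOp_ext_iff {S T : PiLp 2 (fun _ : Fin n => K) →L[ℂ] PiLp 2 (fun _ : Fin n => H)} :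
    S = T ↔ ∀ v i, S v i = T v i :=
  ⟨fun h _ _ => by rw [h], fun h => ContinuousLinearMap.ext fun v => PiLp.ext (h v)⟩

theorem matOp_injective :
    Function.Injective (matOp : Matrix (Fin n) (Fin n) (K →L[ℂ] H) → _) := by
  intro M N h
  ext i j k
  have := matOp_ext_iff.1 h (WithLp.toLp 2 (Pi.single j k)) i
  simp only [matOp_apply] at this
  have key : ∀ M : Matrix (Fin n) (Fin n) (K →L[ℂ] H),
      ∑ j', M i j' ((Pi.single j k : Fin n → K) j') = M i j k := by
    intro M
    rw [Finset.sum_eq_single j]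
    · simp
    · intro b _ hb
      simp [Pi.single_eq_of_ne hb]
    · simp
  rwa [key, key] at this

theorem matOp_zero : matOp (0 : Matrix (Fin n) (Fin n) (K →L[ℂ] H)) = 0 := by
  rw [matOp_ext_iff]
  simp [matOp_apply]

theorem matOp_add (M N : Matrix (Fin n) (Fin n) (K →L[ℂ] H)) :
    matOp (M + N) = matOp M + matOp N := by
  rw [matOp_ext_iff]
  intro v i
  simp [matOp_apply, Finset.sum_add_distrib]

theorem matOp_smul (r : ℂ) (M : Matrix (Fin n) (Fin n) (K →L[ℂ] H)) :
    matOp (r • M) = r • matOp M := by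
  rw [matOp_ext_iff]
  intro v i
  simp [matOp_apply, Finset.smul_sum]

theorem matOp_one : matOp (1 : Matrix (Fin n) (Fin n) (H →L[ℂ] H)) = 1 := by
  rw [matOp_ext_iff]
  intro v i
  rw [matOp_apply, Finset.sum_eq_single i]
  · simp
  · intro j _ hj
    simp [Matrix.one_apply_ne hj.symm]
  · simp

theorem matOp_mul (M N : Matrix (Fin n) (Fin n) (H →L[ℂ] H)) :
    matOp (M * N) = matOp M * matOp N := by
  rw [matOp_ext_iff]
  intro v i
  simp only [matOp_apply, Matrix.mul_apply, mul_apply_eq_comp,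
    sum_apply, map_sum]
  rw [Finset.sum_comm]

theorem matOp_adjoint [CompleteSpace H] [CompleteSpace K]
    (M : Matrix (Fin n) (Fin n) (K →L[ℂ] H)) :
    (matOp M).adjoint = matOp (.of fun i j => (M j i).adjoint) := by
  symm
  rw [ContinuousLinearMap.eq_adjoint_iff]
  intro x y
  simp only [PiLp.inner_apply, matOp_apply, sum_inner, inner_sum, Matrix.of_apply,
    ContinuousLinearMap.adjoint_inner_left]
  rw [Finset.sum_comm]

end MatOp

/-! ### Positivity of $2\times2$ operator matrices as a quadratic form. -/

section BlockPos

variable {H K : Type*} [NormedAddCommGroup H] [InnerProductSpace ℂ H]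
  [NormedAddCommGroup K] [InnerProductSpace ℂ K]

/-- The quadratic form of the operator matrix `[[p, q], [q⋆, r]]` is nonnegative. -/
def BlockPos (p : H →L[ℂ] H) (q : K →L[ℂ] H) (r : K →L[ℂ] K) : Prop :=
  ∀ h k, 0 ≤ (⟪p h, h⟫_ℂ).re + 2 * (⟪q k, h⟫_ℂ).re + (⟪r k, k⟫_ℂ).re

namespace BlockPos

variable {p : H →L[ℂ] H} {q : K →L[ℂ] H} {r : K →L[ℂ] K}

theorem left (h : BlockPos p q r) (v : H) : 0 ≤ (⟪p v, v⟫_ℂ).re := by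
  simpa using h v 0

theorem right (h : BlockPos p q r) (v : K) : 0 ≤ (⟪r v, v⟫_ℂ).re := by
  simpa using h 0 v

theorem conj (h : BlockPos p q r) {e : H →L[ℂ] H} {f : K →L[ℂ] K}
    (he : ∀ x y, ⟪e x, y⟫_ℂ = ⟪x, e y⟫_ℂ) (hf : ∀ x y, ⟪f x, y⟫_ℂ = ⟪x, f y⟫_ℂ) :
    BlockPos (e ∘L p ∘L e) (e ∘L q ∘L f) (f ∘L r ∘L f) := by
  intro x y
  simpa [he, hf] using h (e x) (f y)

/-- For fixed vectors the form is affine in $\varepsilon$, so let $\varepsilon\to0^+$. The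
directions `a`, `b` are arbitrary because they will be the amplified $\theta(1)$, $\pi(1)$, which
need not be identities. -/
theorem of_perturb {a : H →L[ℂ] H} {b : K →L[ℂ] K}
    (h : ∀ ε : ℝ, 0 < ε → BlockPos (p + (ε : ℂ) • a) q (r + (ε : ℂ) • b)) : BlockPos p q r := by
  intro x y
  set s := (⟪p x, x⟫_ℂ).re + 2 * (⟪q y, x⟫_ℂ).re + (⟪r y, y⟫_ℂ).re
  set t := (⟪a x, x⟫_ℂ).re + (⟪b y, y⟫_ℂ).re
  have hε : ∀ ε : ℝ, 0 < ε → 0 ≤ s + ε * t := by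
    intro ε hε
    have := h ε hε x y
    simp only [add_apply, smul_apply, inner_add_left,
      inner_smul_left, Complex.conj_ofReal, Complex.add_re, Complex.re_ofReal_mul] at this
    simp only [s, t]
    linarith
  have hlim : Filter.Tendsto (fun ε : ℝ => s + ε * t) (nhdsWithin 0 (Set.Ioi 0)) (nhds s) := by
    have : Filter.Tendsto (fun ε : ℝ => s + ε * t) (nhds 0) (nhds (s + 0 * t)) :=
      (by fun_prop : Continuous fun ε : ℝ => s + ε * t).tendsto 0
    rw [zero_mul, add_zero] at this
    exact this.mono_left nhdsWithin_le_nhds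
  exact ge_of_tendsto hlim (Filter.eventually_of_mem self_mem_nhdsWithin fun ε hx => hε ε hx)

theorem add_perturb (h : BlockPos p q r) {ε : ℝ} (hε : 0 < ε) :
    BlockPos (p + (ε : ℂ) • 1) q (r + (ε : ℂ) • 1) := by
  intro x y
  have h0 := h x y
  have h1 : 0 ≤ ε * (⟪x, x⟫_ℂ).re := mul_nonneg hε.le (inner_self_nonneg (𝕜 := ℂ))
  have h2 : 0 ≤ ε * (⟪y, y⟫_ℂ).re := mul_nonneg hε.le (inner_self_nonneg (𝕜 := ℂ))
  simp only [add_apply, smul_apply, inner_add_left,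
    inner_smul_left, Complex.conj_ofReal, Complex.add_re, Complex.re_ofReal_mul,
    one_apply_eq_self]
  linarith

/-- This is the bridge between order and norm, used both for the compressed corner and for the
$2\times2$ matrix trick. -/
theorem scalar_iff {t : ℝ} (ht : 0 ≤ t) :
    BlockPos ((t : ℂ) • (1 : H →L[ℂ] H)) q ((t : ℂ) • (1 : K →L[ℂ] K)) ↔ ‖q‖ ≤ t := by
  have key : ∀ (x : H) (y : K), (⟪((t : ℂ) • (1 : H →L[ℂ] H)) x, x⟫_ℂ).re +
      2 * (⟪q y, x⟫_ℂ).re + (⟪((t : ℂ) • (1 : K →L[ℂ] K)) y, y⟫_ℂ).re =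
      t * ‖x‖ ^ 2 + 2 * (⟪q y, x⟫_ℂ).re + t * ‖y‖ ^ 2 := by
    intro x y
    simp only [smul_apply, one_apply_eq_self, inner_smul_left,
      Complex.conj_ofReal, Complex.re_ofReal_mul]
    rw [← RCLike.re_eq_complex_re, inner_self_eq_norm_sq (𝕜 := ℂ), inner_self_eq_norm_sq (𝕜 := ℂ)]
  constructor
  · intro h
    refine q.opNorm_le_bound ht fun y => ?_
    by_cases hq : ‖q y‖ = 0
    · rw [hq]; positivity
    by_cases hy : ‖y‖ = 0
    · exact absurd (by simp [norm_eq_zero.1 hy]) hq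
    -- The test vector has norm $\|y\|$ and points against $qy$, so the form becomes
    -- $2\|y\|(t\|y\|-\|qy\|)$.
    have h1 := h (-((‖y‖ / ‖q y‖ : ℝ) : ℂ) • q y) y
    rw [key] at h1
    rw [inner_smul_right, ← Complex.ofReal_neg, Complex.re_ofReal_mul,
      ← RCLike.re_eq_complex_re, inner_self_eq_norm_sq (𝕜 := ℂ), norm_smul, Complex.norm_real,
      Real.norm_eq_abs, abs_neg, abs_of_nonneg (by positivity)] at h1
    have h2 : ‖y‖ / ‖q y‖ * ‖q y‖ = ‖y‖ := by field_simp
    rw [h2] at h1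
    have h3 : -(‖y‖ / ‖q y‖) * ‖q y‖ ^ 2 = -(‖y‖ * ‖q y‖) := by
      rw [pow_two, ← mul_assoc, neg_mul, h2, neg_mul]
    rw [h3] at h1
    have hy' : 0 < ‖y‖ := lt_of_le_of_ne (norm_nonneg _) (Ne.symm hy)
    nlinarith
  · intro h x y
    rw [key]
    have h1 : -(‖q y‖ * ‖x‖) ≤ (⟪q y, x⟫_ℂ).re :=
      (abs_le.1 ((Complex.abs_re_le_norm _).trans (norm_inner_le_norm (q y) x))).1
    have h2 : ‖q y‖ * ‖x‖ ≤ t * ‖y‖ * ‖x‖ := by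
      gcongr
      exact q.le_of_opNorm_le h y
    nlinarith [mul_nonneg ht (sq_nonneg (‖x‖ - ‖y‖))]

theorem one_iff : BlockPos (1 : H →L[ℂ] H) q (1 : K →L[ℂ] K) ↔ ‖q‖ ≤ 1 := by
  simpa using scalar_iff (q := q) zero_le_one

end BlockPos

theorem block_injective {a a' : H →L[ℂ] H} {b b' : K →L[ℂ] H} {c c' : H →L[ℂ] K}
    {d d' : K →L[ℂ] K} (h : block a b c d = block a' b' c' d') :
    a = a' ∧ b = b' ∧ c = c' ∧ d = d' := by
  have key : ∀ x y, a x + b y = a' x + b' y ∧ c x + d y = c' x + d' y := by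
    intro x y
    have := congrArg (fun T => T (WithLp.toLp 2 (x, y))) h
    simpa [block_apply] using this
  refine ⟨?_, ?_, ?_, ?_⟩ <;> ext x
  · simpa using (key x 0).1
  · simpa using (key 0 x).1
  · simpa using (key x 0).2
  · simpa using (key 0 x).2

variable [CompleteSpace H] [CompleteSpace K] {n : ℕ}

theorem matOp_isSelfAdjoint_iff {M : Matrix (Fin n) (Fin n) (H →L[ℂ] H)} :
    IsSelfAdjoint (matOp M) ↔ ∀ i j, (M j i).adjoint = M i j := by
  rw [ContinuousLinearMap.isSelfAdjoint_iff', matOp_adjoint, matOp_injective.eq_iff]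
  exact ⟨fun h i j => congrFun (congrFun h i) j, fun h => by ext1 i j; exact h i j⟩

/-- The canonical shuffle $(H\oplus K)^n\cong H^n\oplus K^n$, carried out on vectors inside the
quadratic form. Selfadjointness is compared entry by entry, which is possible because `matOp` and
`block` determine their entries. -/
theorem isPositive_matOp_block {p : Matrix (Fin n) (Fin n) (H →L[ℂ] H)}
    {q s : Matrix (Fin n) (Fin n) (K →L[ℂ] H)} {r : Matrix (Fin n) (Fin n) (K →L[ℂ] K)} :
    (matOp (.of fun i j => block (p i j) (q i j) (s i j).adjoint (r i j))).IsPositive ↔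
      (∀ i j, (p j i).adjoint = p i j) ∧ (∀ i j, s j i = q i j) ∧
        (∀ i j, (r j i).adjoint = r i j) ∧ BlockPos (matOp p) (matOp q) (matOp r) := by
  have hsa : IsSelfAdjoint (matOp (.of fun i j => block (p i j) (q i j) (s i j).adjoint (r i j))) ↔
      (∀ i j, (p j i).adjoint = p i j) ∧ (∀ i j, s j i = q i j) ∧
        (∀ i j, (r j i).adjoint = r i j) := by
    have key : ∀ i j, (block (p j i) (q j i) (s j i).adjoint (r j i)).adjoint =
        block (p j i).adjoint (s j i) (q j i).adjoint (r j i).adjoint := by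
      intro i j
      refine (block_star _ _ _ _).trans ?_
      rw [ContinuousLinearMap.adjoint_adjoint]
    rw [matOp_isSelfAdjoint_iff]
    constructor
    · intro h
      have h' := fun i j => block_injective ((key i j).symm.trans (h i j))
      exact ⟨fun i j => (h' i j).1, fun i j => (h' i j).2.1, fun i j => (h' i j).2.2.2⟩
    · rintro ⟨h1, h2, h3⟩ i j
      refine (key i j).trans ?_
      rw [Matrix.of_apply, h1, h3, h2, h2]
  have hform : (∀ i j, s j i = q i j) → ∀ (h : PiLp 2 fun _ : Fin n => H)
      (k : PiLp 2 fun _ : Fin n => K),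
      (⟪matOp (.of fun i j => block (p i j) (q i j) (s i j).adjoint (r i j))
        (WithLp.toLp 2 fun i => WithLp.toLp 2 (h i, k i)),
        (WithLp.toLp 2 fun i => WithLp.toLp 2 (h i, k i))⟫_ℂ).re =
      (⟪matOp p h, h⟫_ℂ).re + 2 * (⟪matOp q k, h⟫_ℂ).re + (⟪matOp r k, k⟫_ℂ).re := by
    intro hs h k
    have hadj : (⟪(matOp q).adjoint h, k⟫_ℂ).re = (⟪matOp q k, h⟫_ℂ).re := by
      rw [ContinuousLinearMap.adjoint_inner_left, ← inner_conj_symm, Complex.conj_re]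
    -- One of the two equal cross terms is turned into the contribution of the lower left corner.
    rw [two_mul]
    nth_rewrite 2 [← hadj]
    rw [matOp_adjoint]
    simp only [PiLp.inner_apply, matOp_apply, sum_inner, Complex.re_sum, block_apply,
      Matrix.of_apply]
    simp only [WithLp.prod_inner_apply, inner_add_left, Complex.add_re, Finset.sum_add_distrib, hs, WithLp.toLp_fst,
      WithLp.toLp_snd]
    ring
  rw [← ContinuousLinearMap.nonneg_iff_isPositive, ContinuousLinearMap.nonneg_iff_isPositive]
  constructor
  · intro h
    have h1 := hsa.1 h.isSelfAdjoint
    refine ⟨h1.1, h1.2.1, h1.2.2, fun x y => ?_⟩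
    rw [← hform h1.2.1]
    exact h.2 _
  · rintro ⟨h1, h2, h3, h4⟩
    refine ⟨(hsa.2 ⟨h1, h2, h3⟩).isSymmetric, fun v => ?_⟩
    have := h4 (WithLp.toLp 2 fun i => (v i).fst) (WithLp.toLp 2 fun i => (v i).snd)
    rw [← hform h2] at this
    exact this

end BlockPos

/-! ### Invertible square roots in matrix algebras over a C*-algebra. -/

section Sqrt

/-- Functional calculus with $\sqrt{|x|+\varepsilon}$ and its reciprocal, both continuous on all of
$\mathbb R$. The absolute value avoids any order on `E`: positivity is known only for the image of
`a`. -/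
theorem exists_sqrt_add {E F : Type*} [CStarAlgebra E] [CStarAlgebra F] [PartialOrder F]
    [StarOrderedRing F] (φ : E →⋆ₐ[ℂ] F) (hφ : Function.Injective φ) {a : E}
    (ha : IsSelfAdjoint a) (hpos : 0 ≤ φ a) {ε : ℝ} (hε : 0 < ε) :
    ∃ e f : E, star e = e ∧ star f = f ∧ e * f = 1 ∧ f * e = 1 ∧ e * e = a + (ε : ℂ) • 1 := by
  have hpos' : ∀ x : ℝ, 0 < |x| + ε := fun x => by positivity
  -- By injectivity this can be checked after applying `φ`, where the spectrum is nonnegative.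
  have hab : cfc (fun x : ℝ => |x|) a = a := by
    refine hφ ?_
    rw [StarAlgHom.map_cfc φ (fun x : ℝ => |x|) a (by fun_prop)
      (NonUnitalStarAlgHom.isometry φ hφ).continuous ha hpos.isSelfAdjoint]
    conv_rhs => rw [← cfc_id ℝ (φ a) hpos.isSelfAdjoint]
    exact cfc_congr fun x hx => abs_of_nonneg (spectrum_nonneg_of_nonneg hpos hx)
  have hc : Continuous fun x : ℝ => Real.sqrt (|x| + ε) := by fun_prop
  have hc' : Continuous fun x : ℝ => (Real.sqrt (|x| + ε))⁻¹ :=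
    hc.inv₀ fun x => (Real.sqrt_pos.2 (hpos' x)).ne'
  refine ⟨cfc (fun x : ℝ => Real.sqrt (|x| + ε)) a, cfc (fun x : ℝ => (Real.sqrt (|x| + ε))⁻¹) a,
    cfc_predicate (R := ℝ) _ a, cfc_predicate (R := ℝ) _ a, ?_, ?_, ?_⟩
  · rw [← cfc_mul _ _ a hc.continuousOn hc'.continuousOn, ← cfc_one ℝ a ha]
    exact cfc_congr fun x _ => mul_inv_cancel₀ (Real.sqrt_pos.2 (hpos' x)).ne'
  · rw [← cfc_mul _ _ a hc'.continuousOn hc.continuousOn, ← cfc_one ℝ a ha]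
    exact cfc_congr fun x _ => inv_mul_cancel₀ (Real.sqrt_pos.2 (hpos' x)).ne'
  · rw [← cfc_mul _ _ a hc.continuousOn hc.continuousOn]
    have : cfc (fun x : ℝ => Real.sqrt (|x| + ε) * Real.sqrt (|x| + ε)) a =
        cfc (fun x : ℝ => |x| + ε) a :=
      cfc_congr fun x _ => Real.mul_self_sqrt (hpos' x).le
    rw [this, cfc_add a (fun x : ℝ => |x|) (fun _ => ε) (by fun_prop) (by fun_prop), hab,
      cfc_const ε a ha, Algebra.algebraMap_eq_smul_one, Complex.coe_smul]

/-- The amplification of a representation, as a representation of the matrix algebra. -/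
noncomputable def matRep {C H : Type*} [CStarAlgebra C] [PartialOrder C] [StarOrderedRing C]
    [NormedAddCommGroup H] [InnerProductSpace ℂ H] [CompleteSpace H] (n : ℕ)
    (φ : C →⋆ₐ[ℂ] (H →L[ℂ] H)) :
    CStarMatrix (Fin n) (Fin n) C →⋆ₐ[ℂ]
      (PiLp 2 (fun _ : Fin n => H) →L[ℂ] PiLp 2 (fun _ : Fin n => H)) where
  toFun M := matOp ((CStarMatrix.ofMatrix.symm M).map φ)
  map_one' := by
    have : (CStarMatrix.ofMatrix.symm (1 : CStarMatrix (Fin n) (Fin n) C)).map φ = 1 :=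
      Matrix.map_one φ (map_zero φ) (map_one φ)
    rw [this, matOp_one]
  map_mul' M N := by
    rw [← matOp_mul]
    congr 1
    exact Matrix.map_mul (L := CStarMatrix.ofMatrix.symm M) (M := CStarMatrix.ofMatrix.symm N)
      (f := (φ : C →+* (H →L[ℂ] H)))
  map_zero' := by
    rw [matOp_ext_iff]
    intro v i
    simp [matOp_apply]
  map_add' M N := by
    rw [← matOp_add]
    congr 1
    exact Matrix.map_add φ (map_add φ) _ _
  commutes' r := by
    have : (CStarMatrix.ofMatrix.symm (algebraMap ℂ (CStarMatrix (Fin n) (Fin n) C) r)).map φ =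
        r • 1 := by
      ext1 i j
      by_cases h : i = j
      · subst h
        simp [Algebra.algebraMap_eq_smul_one]
      · simp [CStarMatrix.algebraMap_apply, h]
    rw [this, matOp_smul, matOp_one, Algebra.algebraMap_eq_smul_one]
  map_star' M := by
    rw [ContinuousLinearMap.star_eq_adjoint, matOp_adjoint]
    congr 1
    ext1 i j
    simp [CStarMatrix.star_apply, map_star, ContinuousLinearMap.star_eq_adjoint]

/-- The roots must lie in $M_n(\mathcal C)$, not merely in $B(H^n)$, so that they can act on
matrices over the bimodule and be carried to another representation. -/
theorem exists_matrix_sqrt_add {C H : Type*} [CStarAlgebra C]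
    [NormedAddCommGroup H] [InnerProductSpace ℂ H] [CompleteSpace H] {n : ℕ}
    (φ : C →⋆ₐ[ℂ] (H →L[ℂ] H)) (hφ : Function.Injective φ) {P : Matrix (Fin n) (Fin n) C}
    (hP : ∀ i j, star (P j i) = P i j)
    (hpos : ∀ v, 0 ≤ (⟪matOp (P.map φ) v, v⟫_ℂ).re) {ε : ℝ} (hε : 0 < ε) :
    ∃ E F : Matrix (Fin n) (Fin n) C, E.conjTranspose = E ∧ F.conjTranspose = F ∧
      E * F = 1 ∧ F * E = 1 ∧ E * E = P + (ε : ℂ) • 1 := by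
  -- The order serves only to give the matrices their C*-algebra structure.
  let _ := CStarAlgebra.spectralOrder C
  have _ := CStarAlgebra.spectralOrderedRing C
  have hsa : IsSelfAdjoint (CStarMatrix.ofMatrix P) := by
    ext i j
    exact hP i j
  have hinj : Function.Injective (matRep n φ) := by
    intro M N h
    have := matOp_injective h
    ext i j
    exact hφ (congrFun (congrFun this i) j)
  refine exists_sqrt_add (matRep n φ) hinj hsa ?_ hε
  rw [ContinuousLinearMap.nonneg_iff_isPositive]
  exact ⟨(hsa.map (matRep n φ)).isSymmetric, hpos⟩

end Sqrt

/-! ### Products of matrices over a bimodule, and their images. -/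

section Compression

variable {C D X : Type*} [Ring C] [Ring D] [AddCommGroup X] [Module C X] [Module Dᵐᵒᵖ X] {n : ℕ}

/-- The product `F * Q * G` of matrices over a bimodule. -/
def biMul (F : Matrix (Fin n) (Fin n) C) (Q : Matrix (Fin n) (Fin n) X)
    (G : Matrix (Fin n) (Fin n) D) : Matrix (Fin n) (Fin n) X :=
  .of fun i j => ∑ l, MulOpposite.op (G l j) • ∑ k, F i k • Q k l

theorem matOp_biMul [Module ℂ X] {H K : Type*} [NormedAddCommGroup H] [InnerProductSpace ℂ H]
    [NormedAddCommGroup K] [InnerProductSpace ℂ K] {θ : C → (H →L[ℂ] H)} {π : D → (K →L[ℂ] K)}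
    {Φ : X →ₗ[ℂ] (K →L[ℂ] H)} (h : IsOpBimoduleMap θ π Φ) (F : Matrix (Fin n) (Fin n) C)
    (Q : Matrix (Fin n) (Fin n) X) (G : Matrix (Fin n) (Fin n) D) :
    matOp ((biMul F Q G).map Φ) = matOp (F.map θ) ∘L matOp (Q.map Φ) ∘L matOp (G.map π) := by
  rw [matOp_ext_iff]
  intro v i
  simp only [matOp_apply, biMul, Matrix.map_apply, Matrix.of_apply, map_sum, h.map_left,
    h.map_right, ContinuousLinearMap.comp_apply, sum_apply]
  rw [Finset.sum_comm]
  conv_rhs => rw [Finset.sum_comm]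
  refine Finset.sum_congr rfl fun k _ => ?_
  rw [Finset.sum_comm]

end Compression

section MapLemmas

variable {C H F : Type*} [CStarAlgebra C] [NormedAddCommGroup H] [InnerProductSpace ℂ H] {n : ℕ}
  [FunLike F C (H →L[ℂ] H)]

theorem matOp_map_mul [NonUnitalAlgHomClass F ℂ C (H →L[ℂ] H)] (θ : F) (M N : Matrix (Fin n) (Fin n) C) :
    matOp ((M * N).map θ) = matOp (M.map θ) ∘L matOp (N.map θ) := by
  rw [← ContinuousLinearMap.mul_def, ← matOp_mul]
  congr 1
  ext1 i j
  simp [Matrix.mul_apply]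

/-- The image of the identity matrix is kept as it stands, since `θ` may be degenerate. -/
theorem matOp_map_add_smul_one [NonUnitalAlgHomClass F ℂ C (H →L[ℂ] H)] (θ : F) (M : Matrix (Fin n) (Fin n) C) (r : ℂ) :
    matOp ((M + r • 1).map θ) =
      matOp (M.map θ) + r • matOp ((1 : Matrix (Fin n) (Fin n) C).map θ) := by
  rw [← matOp_smul, ← matOp_add]
  congr 1
  ext1 i j
  simp

theorem matOp_map_symmetric [CompleteSpace H] [StarHomClass F C (H →L[ℂ] H)] (θ : F)
    {M : Matrix (Fin n) (Fin n) C} (hM : M.conjTranspose = M) (x y) :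
    ⟪matOp (M.map θ) x, y⟫_ℂ = ⟪x, matOp (M.map θ) y⟫_ℂ := by
  have : (matOp (M.map θ)).adjoint = matOp (M.map θ) := by
    rw [matOp_adjoint]
    congr 1
    ext1 i j
    conv_rhs => rw [← hM]
    simp [map_star, ContinuousLinearMap.star_eq_adjoint]
  conv_lhs => rw [← this]
  rw [ContinuousLinearMap.adjoint_inner_left]

end MapLemmas

theorem biMul_one {C D X : Type*} [Ring C] [Ring D] [AddCommGroup X] [Module C X]
    [Module Dᵐᵒᵖ X] {n : ℕ} (Q : Matrix (Fin n) (Fin n) X) :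
    biMul (1 : Matrix (Fin n) (Fin n) C) Q (1 : Matrix (Fin n) (Fin n) D) = Q := by
  ext i j
  simp only [biMul, Matrix.of_apply]
  rw [Finset.sum_eq_single j, Finset.sum_eq_single i]
  · simp
  · intro k _ hk
    simp [Matrix.one_apply_ne hk.symm]
  · simp
  · intro l _ hl
    simp [Matrix.one_apply_ne hl]
  · simp

/-! ### Transfer of positivity from a faithful representation. -/

namespace FaithfulCES

variable {C D Xt H' K' H K : Type*} [CStarAlgebra C] [CStarAlgebra D]
  [AddCommGroup Xt] [Module ℂ Xt] [Module C Xt] [Module Dᵐᵒᵖ Xt] {μ : MatNorm Xt}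
  [NormedAddCommGroup H'] [InnerProductSpace ℂ H'] [CompleteSpace H']
  [NormedAddCommGroup K'] [InnerProductSpace ℂ K'] [CompleteSpace K']
  [NormedAddCommGroup H] [InnerProductSpace ℂ H] [CompleteSpace H]
  [NormedAddCommGroup K] [InnerProductSpace ℂ K] [CompleteSpace K]

omit [CompleteSpace H] [CompleteSpace K] in
-- The $1\times1$ norm of the difference vanishes under `R.corner`, hence under `Φ`. Since `μ` is a
-- bare family of functions, comparing values of `μ` replaces an appeal to injectivity of the corner
-- map; this is what makes the map on the system well defined.
theorem map_eq_of_corner_eq (R : FaithfulCES C D μ H' K') {Φ : Xt →ₗ[ℂ] (K →L[ℂ] H)}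
    (hΦ : IsCC μ (opNorms K H) Φ) {x y : Xt} (h : R.corner x = R.corner y) : Φ x = Φ y := by
  have h0 : R.corner (x - y) = 0 := by rw [map_sub, h, sub_self]
  have h1 : ‖matOp (.of fun _ _ : Fin 1 => Φ (x - y))‖ ≤
      ‖matOp (.of fun _ _ : Fin 1 => R.corner (x - y))‖ :=
    (hΦ 1 (.of fun _ _ => x - y)).trans_eq (R.corner_isCI 1 (.of fun _ _ => x - y)).symm
  have h2 : (.of fun _ _ => (0 : K' →L[ℂ] H') : Matrix (Fin 1) (Fin 1) _) = 0 := rfl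
  rw [h0, h2, matOp_zero, ContinuousLinearMap.opNorm_zero] at h1
  have h3 : matOp (.of fun _ _ : Fin 1 => Φ (x - y)) = matOp 0 := by
    rw [matOp_zero]
    exact ContinuousLinearMap.ext fun v =>
      norm_le_zero_iff.1 ((ContinuousLinearMap.le_of_opNorm_le _ h1 v).trans_eq (zero_mul _))
  have h4 : Φ (x - y) = 0 := congrFun (congrFun (matOp_injective h3) 0) 0
  rwa [map_sub, sub_eq_zero] at h4

/-- Positivity of the quadratic form passes from a faithful representation to any other one. -/
theorem blockPos_map (R : FaithfulCES C D μ H' K') {θ : C →⋆ₙₐ[ℂ] (H →L[ℂ] H)}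
    {π : D →⋆ₙₐ[ℂ] (K →L[ℂ] K)} {Φ : Xt →ₗ[ℂ] (K →L[ℂ] H)} (hΦ : IsCC μ (opNorms K H) Φ)
    (hbi : IsOpBimoduleMap θ π Φ) {n : ℕ} {P : Matrix (Fin n) (Fin n) C}
    {Q : Matrix (Fin n) (Fin n) Xt} {S : Matrix (Fin n) (Fin n) D}
    (hP : ∀ i j, star (P j i) = P i j) (hS : ∀ i j, star (S j i) = S i j)
    (h : BlockPos (matOp (P.map R.left)) (matOp (Q.map R.corner)) (matOp (S.map R.right))) :
    BlockPos (matOp (P.map θ)) (matOp (Q.map Φ)) (matOp (S.map π)) := by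
  -- Perturbing by $\varepsilon\theta(1)$ and $\varepsilon\pi(1)$ makes the diagonal exactly
  -- $\theta(E)^2$ and $\pi(E')^2$, even for degenerate representations.
  refine BlockPos.of_perturb (a := matOp ((1 : Matrix (Fin n) (Fin n) C).map θ))
    (b := matOp ((1 : Matrix (Fin n) (Fin n) D).map π)) fun ε hε => ?_
  obtain ⟨E, F, hE, hF, hEF, hFE, hEE⟩ :=
    exists_matrix_sqrt_add R.left R.left_injective hP h.left hε
  obtain ⟨E', F', hE', hF', hEF', hFE', hEE'⟩ :=
    exists_matrix_sqrt_add R.right R.right_injective hS h.right hε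
  have one_l : matOp ((1 : Matrix (Fin n) (Fin n) C).map R.left) = 1 := by
    rw [Matrix.map_one _ (map_zero _) (map_one _), matOp_one]
  have one_r : matOp ((1 : Matrix (Fin n) (Fin n) D).map R.right) = 1 := by
    rw [Matrix.map_one _ (map_zero _) (map_one _), matOp_one]
  -- Conjugating the perturbed matrix by $F\oplus F'$ makes both diagonal entries the identity,
  -- leaving a norm bound on $FQF'$.
  have hnorm : ‖matOp ((biMul F Q F').map R.corner)‖ ≤ 1 := by
    rw [← BlockPos.one_iff, matOp_biMul R.corner_bimodule]
    have h1 := h.add_perturb hε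
    rw [← one_l, ← one_r, ← matOp_map_add_smul_one, ← matOp_map_add_smul_one, ← hEE, ← hEE'] at h1
    have h2 := h1.conj (matOp_map_symmetric R.left hF) (matOp_map_symmetric R.right hF')
    rwa [← matOp_map_mul, ← matOp_map_mul, ← matOp_map_mul, ← matOp_map_mul,
      show F * (E * E * F) = 1 by rw [mul_assoc E, hEF, mul_one, hFE],
      show F' * (E' * E' * F') = 1 by rw [mul_assoc E', hEF', mul_one, hFE'], one_l, one_r] at h2
  have hnorm' : ‖matOp ((biMul F Q F').map Φ)‖ ≤ 1 :=
    (hΦ n _).trans ((R.corner_isCI n _).symm.trans_le hnorm)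
  have h3 := (BlockPos.one_iff.2 hnorm').conj (matOp_map_symmetric θ hE)
    (matOp_map_symmetric π hE')
  -- Degeneracy is harmless here: $EF=1$ and $F'E'=1$ are absorbed by the module action on $Q$
  -- before `Φ` is applied.
  have hq : matOp (E.map θ) ∘L matOp ((biMul F Q F').map Φ) ∘L matOp (E'.map π) =
      matOp (Q.map Φ) := by
    rw [matOp_biMul hbi]
    calc _ = (matOp (E.map θ) ∘L matOp (F.map θ)) ∘L matOp (Q.map Φ) ∘L
          (matOp (F'.map π) ∘L matOp (E'.map π)) := by
          simp only [ContinuousLinearMap.comp_assoc]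
      _ = _ := by
          rw [← matOp_map_mul, ← matOp_map_mul, hEF, hFE', ← matOp_biMul hbi, biMul_one]
  rw [← matOp_map_add_smul_one, ← matOp_map_add_smul_one, ← hEE, ← hEE', matOp_map_mul,
    matOp_map_mul]
  rw [hq] at h3
  exact h3

theorem exists_elt (R : FaithfulCES C D μ H K) (s : R.system) :
    ∃ (c : C) (x y : Xt) (d : D), s = R.elt c x y d := by
  obtain ⟨_, c, x, y, d, rfl⟩ := s
  exact ⟨c, x, y, d, rfl⟩

theorem elt_add (R : FaithfulCES C D μ H K) (c c' : C) (x x' y y' : Xt) (d d' : D) :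
    R.elt c x y d + R.elt c' x' y' d' = R.elt (c + c') (x + x') (y + y') (d + d') :=
  Subtype.ext (by simp [elt, mat, block_add])

theorem smul_elt (R : FaithfulCES C D μ H K) (r : ℂ) (c : C) (x y : Xt) (d : D) :
    r • R.elt c x y d = R.elt (r • c) (r • x) (starRingEnd ℂ r • y) (r • d) :=
  Subtype.ext (by simp [elt, mat, block_smul, map_smulₛₗ _ (starRingEnd ℂ r)])

theorem coe_elt (R : FaithfulCES C D μ H K) (c : C) (x y : Xt) (d : D) :
    (R.elt c x y d : WithLp 2 (H × K) →L[ℂ] WithLp 2 (H × K)) = R.mat c x y d := rfl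

theorem mat_one (R : FaithfulCES C D μ H K) : R.mat 1 0 0 1 = 1 := by
  simp [mat, block_one]

theorem star_mat (R : FaithfulCES C D μ H K) (c : C) (x y : Xt) (d : D) :
    star (R.mat c x y d) = R.mat (star c) y x (star d) := by
  simp [mat, block_star, ← ContinuousLinearMap.star_eq_adjoint, map_star]

/-- The zero lower left corners keep the product inside the system: otherwise terms $\tilde x\tilde
y^*$ would appear on the diagonal. -/
theorem mat_mul_mat_zero (R : FaithfulCES C D μ H K) (c c' : C) (x x' : Xt) (d d' : D) :
    R.mat c x 0 d * R.mat c' x' 0 d' =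
      R.mat (c * c') (c • x' + MulOpposite.op d' • x) 0 (d * d') := by
  simp only [mat]
  rw [block_mul]
  simp [R.corner_bimodule.map_left, R.corner_bimodule.map_right, ContinuousLinearMap.mul_def]

theorem exists_completelyPositive (R : FaithfulCES C D μ H' K') {θ : C →⋆ₙₐ[ℂ] (H →L[ℂ] H)}
    {π : D →⋆ₙₐ[ℂ] (K →L[ℂ] K)} {Φ : Xt →ₗ[ℂ] (K →L[ℂ] H)} (hΦ : IsCC μ (opNorms K H) Φ)
    (hbi : IsOpBimoduleMap θ π Φ) :
    ∃ Ψ : R.system →ₗ[ℂ] (WithLp 2 (H × K) →L[ℂ] WithLp 2 (H × K)),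
      (∀ (c : C) (x y : Xt) (d : D),
        Ψ (R.elt c x y d) = block (θ c) (Φ x) (Φ y).adjoint (π d)) ∧
      IsCompletelyPositive Ψ := by
  -- Entries are chosen arbitrarily for each element; `hΨ` shows that the value does not depend on
  -- the choice, and linearity follows from that.
  choose c x y d hs using R.exists_elt
  have hΨ : ∀ c₀ x₀ y₀ d₀, block (θ (c (R.elt c₀ x₀ y₀ d₀))) (Φ (x (R.elt c₀ x₀ y₀ d₀)))
      (Φ (y (R.elt c₀ x₀ y₀ d₀))).adjoint (π (d (R.elt c₀ x₀ y₀ d₀))) =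
        block (θ c₀) (Φ x₀) (Φ y₀).adjoint (π d₀) := by
    intro c₀ x₀ y₀ d₀
    obtain ⟨h1, h2, h3, h4⟩ :=
      block_injective (congrArg Subtype.val (hs (R.elt c₀ x₀ y₀ d₀)))
    rw [← R.left_injective h1, ← R.right_injective h4, ← R.map_eq_of_corner_eq hΦ h2,
      ← R.map_eq_of_corner_eq hΦ (ContinuousLinearMap.adjoint.injective h3)]
  refine ⟨{ toFun := fun s => block (θ (c s)) (Φ (x s)) (Φ (y s)).adjoint (π (d s))
            map_add' := fun s t => ?_
            map_smul' := fun r s => ?_ }, hΨ, fun n M hM => ?_⟩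
  · conv_lhs => rw [hs s, hs t, elt_add, hΨ]
    simp [block_add]
  · conv_lhs => rw [hs s, smul_elt, hΨ]
    simp [block_smul, map_smulₛₗ _ (starRingEnd ℂ r)]
  · have hM' : M.map (Subtype.val : R.system → _) = .of fun i j =>
        block (R.left (c (M i j))) (R.corner (x (M i j))) (R.corner (y (M i j))).adjoint
          (R.right (d (M i j))) := by
      ext1 i j
      exact congrArg Subtype.val (hs (M i j))
    rw [hM'] at hM
    obtain ⟨h1, h2, h3, h4⟩ := isPositive_matOp_block.1 hM
    have hP : ∀ i j, star (c (M j i)) = c (M i j) := fun i j =>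
      R.left_injective (by rw [map_star]; exact h1 i j)
    have hS : ∀ i j, star (d (M j i)) = d (M i j) := fun i j =>
      R.right_injective (by rw [map_star]; exact h3 i j)
    refine isPositive_matOp_block.2 ⟨fun i j => ?_, fun i j => R.map_eq_of_corner_eq hΦ (h2 i j),
      fun i j => ?_, R.blockPos_map hΦ hbi hP hS h4⟩
    · exact (map_star θ _).symm.trans (congrArg θ (hP i j))
    · exact (map_star π _).symm.trans (congrArg π (hS i j))

end FaithfulCES

/-! ### The $2\times2$ matrix trick: unital complete positivity gives complete contractivity. -/

section Contractive

variable {N N' : Type*} [NormedAddCommGroup N] [InnerProductSpace ℂ N] [CompleteSpace N]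
  [NormedAddCommGroup N'] [InnerProductSpace ℂ N'] [CompleteSpace N'] {n : ℕ}

/-- The `2n × 2n` matrix `[[t, M], [M⋆, t]]`. -/
def dilate {E : Type*} [Zero E] (e : E) (M M' : Matrix (Fin n) (Fin n) E) :
    Matrix (Fin (n + n)) (Fin (n + n)) E :=
  (Matrix.fromBlocks (Matrix.diagonal fun _ => e) M M' (Matrix.diagonal fun _ => e)).submatrix
    finSumFinEquiv.symm finSumFinEquiv.symm

/-- Splitting $N^{2n}$ as $N^n\oplus N^n$ reduces this to `BlockPos.scalar_iff`. -/
theorem isPositive_matOp_dilate_iff {M M' : Matrix (Fin n) (Fin n) (N →L[ℂ] N)}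
    (hM : ∀ i j, M' i j = star (M j i)) {t : ℝ} (ht : 0 ≤ t) :
    (matOp (dilate ((t : ℂ) • (1 : N →L[ℂ] N)) M M')).IsPositive ↔ ‖matOp M‖ ≤ t := by
  obtain rfl : M' = .of fun i j => star (M j i) := by ext1 i j; exact hM i j
  have ht' : star ((t : ℂ) • (1 : N →L[ℂ] N)) = (t : ℂ) • (1 : N →L[ℂ] N) := by
    simp
  have hsa : IsSelfAdjoint (matOp (dilate ((t : ℂ) • (1 : N →L[ℂ] N)) M
      (.of fun i j => star (M j i)))) := by
    rw [matOp_isSelfAdjoint_iff]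
    intro i j
    rw [← ContinuousLinearMap.star_eq_adjoint]
    obtain ⟨i, rfl⟩ := finSumFinEquiv.surjective i
    obtain ⟨j, rfl⟩ := finSumFinEquiv.surjective j
    have hd : ∀ i j : Fin n, star ((Matrix.diagonal fun _ : Fin n => (t : ℂ) • (1 : N →L[ℂ] N)) j i) =
        (Matrix.diagonal fun _ : Fin n => (t : ℂ) • (1 : N →L[ℂ] N)) i j := by
      intro i j
      by_cases h : i = j
      · subst h
        rw [Matrix.diagonal_apply_eq, ht']
      · rw [Matrix.diagonal_apply_ne _ h, Matrix.diagonal_apply_ne _ (Ne.symm h), star_zero]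
    rcases i with i | i <;> rcases j with j | j <;>
      simp only [dilate, Matrix.submatrix_apply, Equiv.symm_apply_apply, Matrix.fromBlocks_apply₁₁,
        Matrix.fromBlocks_apply₁₂, Matrix.fromBlocks_apply₂₁, Matrix.fromBlocks_apply₂₂,
        Matrix.of_apply, star_star, hd]
  have hform : ∀ v : PiLp 2 fun _ : Fin (n + n) => N,
      (⟪matOp (dilate ((t : ℂ) • (1 : N →L[ℂ] N)) M (.of fun i j => star (M j i))) v, v⟫_ℂ).re =
      (⟪((t : ℂ) • (1 : (PiLp 2 fun _ : Fin n => N) →L[ℂ] _))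
        (WithLp.toLp 2 fun i => v (Fin.castAdd n i)),
        (WithLp.toLp 2 fun i => v (Fin.castAdd n i))⟫_ℂ).re +
      2 * (⟪matOp M (WithLp.toLp 2 fun i => v (Fin.natAdd n i)),
        (WithLp.toLp 2 fun i => v (Fin.castAdd n i))⟫_ℂ).re +
      (⟪((t : ℂ) • (1 : (PiLp 2 fun _ : Fin n => N) →L[ℂ] _))
        (WithLp.toLp 2 fun i => v (Fin.natAdd n i)),
        (WithLp.toLp 2 fun i => v (Fin.natAdd n i))⟫_ℂ).re := by
    intro v
    set h : PiLp 2 fun _ : Fin n => N := WithLp.toLp 2 fun i => v (Fin.castAdd n i) with hh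
    set k : PiLp 2 fun _ : Fin n => N := WithLp.toLp 2 fun i => v (Fin.natAdd n i) with hk
    have hadj : (⟪(matOp M).adjoint h, k⟫_ℂ).re = (⟪matOp M k, h⟫_ℂ).re := by
      rw [ContinuousLinearMap.adjoint_inner_left, ← inner_conj_symm, Complex.conj_re]
    rw [two_mul]
    nth_rewrite 2 [← hadj]
    rw [matOp_adjoint]
    have hd : ∀ (w : Fin n → N) (i : Fin n),
        ∑ j, (Matrix.diagonal fun _ : Fin n => (t : ℂ) • (1 : N →L[ℂ] N)) i j (w j) =
          (t : ℂ) • w i := by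
      intro w i
      rw [Finset.sum_eq_single i]
      · simp
      · intro j _ hj
        simp [Matrix.diagonal_apply_ne _ hj.symm]
      · simp
    simp only [PiLp.inner_apply, matOp_apply, dilate, Fin.sum_univ_add, Matrix.submatrix_apply,
      finSumFinEquiv_symm_apply_castAdd, finSumFinEquiv_symm_apply_natAdd,
      Matrix.fromBlocks_apply₁₁, Matrix.fromBlocks_apply₁₂, Matrix.fromBlocks_apply₂₁,
      Matrix.fromBlocks_apply₂₂, Matrix.of_apply, hd, inner_add_left, Complex.add_re,
      Finset.sum_add_distrib, hh, hk, smul_apply, one_apply_eq_self, PiLp.smul_apply,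
      ContinuousLinearMap.star_eq_adjoint]
    ring
  rw [← BlockPos.scalar_iff ht]
  constructor
  · intro h x y
    have := h.2 (WithLp.toLp 2 (Fin.append x.ofLp y.ofLp))
    rw [ContinuousLinearMap.reApplyInnerSelf, RCLike.re_eq_complex_re, hform] at this
    simpa only [WithLp.ofLp_toLp, Fin.append_left, Fin.append_right, WithLp.toLp_ofLp] using this
  · intro h
    refine ⟨hsa.isSymmetric, fun v => ?_⟩
    rw [ContinuousLinearMap.reApplyInnerSelf, RCLike.re_eq_complex_re, hform]
    exact h _ _

theorem dilate_map {E F : Type*} [Zero E] [Zero F] (f : E → F) (hf : f 0 = 0) (e : E)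
    (M M' : Matrix (Fin n) (Fin n) E) :
    (dilate e M M').map f = dilate (f e) (M.map f) (M'.map f) := by
  rw [dilate, ← Matrix.submatrix_map, Matrix.fromBlocks_map, Matrix.diagonal_map hf]
  rfl

/-- A unital, selfadjoint, completely positive map on an operator system is completely
contractive. -/
theorem IsCompletelyPositive.norm_matOp_le {S : Submodule ℂ (N →L[ℂ] N)}
    {Ψ : S →ₗ[ℂ] (N' →L[ℂ] N')} (hΨ : IsCompletelyPositive Ψ)
    (hone : ∃ s : S, (s : N →L[ℂ] N) = 1 ∧ Ψ s = 1)
    (hstar : ∀ s : S, ∃ t : S, (t : N →L[ℂ] N) = star (s : N →L[ℂ] N) ∧ Ψ t = star (Ψ s))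
    (M : Matrix (Fin n) (Fin n) S) :
    ‖matOp (M.map Ψ)‖ ≤ ‖matOp (M.map (Subtype.val : S → (N →L[ℂ] N)))‖ := by
  obtain ⟨u, hu, hu'⟩ := hone
  choose σ hσ hσ' using hstar
  set t := ‖matOp (M.map (Subtype.val : S → (N →L[ℂ] N)))‖
  have ht : 0 ≤ t := norm_nonneg _
  -- With $t=\|M\|$ the dilated matrix is positive, and its entries lie in `S` because `S` contains
  -- the unit and adjoints; so complete positivity applies at size $2n$.
  have hpos : (matOp ((dilate ((t : ℂ) • u) M (.of fun i j => σ (M j i))).map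
      (Subtype.val : S → (N →L[ℂ] N)))).IsPositive := by
    rw [dilate_map _ rfl, Submodule.coe_smul, hu]
    exact (isPositive_matOp_dilate_iff (fun i j => hσ (M j i)) ht).2 le_rfl
  have hpos' := hΨ _ _ hpos
  rw [dilate_map _ (map_zero Ψ), map_smul, hu'] at hpos'
  exact (isPositive_matOp_dilate_iff (fun i j => hσ' (M j i)) ht).1 hpos'

end Contractive

/-! ### Independence of the faithful representation. -/

namespace FaithfulCES

variable {C D Xt H₁ K₁ H₂ K₂ : Type*} [CStarAlgebra C] [CStarAlgebra D]
  [AddCommGroup Xt] [Module ℂ Xt] [Module C Xt] [Module Dᵐᵒᵖ Xt] {μ : MatNorm Xt}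
  [NormedAddCommGroup H₁] [InnerProductSpace ℂ H₁] [CompleteSpace H₁]
  [NormedAddCommGroup K₁] [InnerProductSpace ℂ K₁] [CompleteSpace K₁]
  [NormedAddCommGroup H₂] [InnerProductSpace ℂ H₂] [CompleteSpace H₂]
  [NormedAddCommGroup K₂] [InnerProductSpace ℂ K₂] [CompleteSpace K₂]

theorem exists_completelyPositive_mat (R₁ : FaithfulCES C D μ H₁ K₁)
    (R₂ : FaithfulCES C D μ H₂ K₂) :
    ∃ Ψ : R₁.system →ₗ[ℂ] (WithLp 2 (H₂ × K₂) →L[ℂ] WithLp 2 (H₂ × K₂)),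
      (∀ (c : C) (x y : Xt) (d : D), Ψ (R₁.elt c x y d) = R₂.mat c x y d) ∧
      IsCompletelyPositive Ψ :=
  R₁.exists_completelyPositive (θ := (R₂.left : C →⋆ₙₐ[ℂ] (H₂ →L[ℂ] H₂)))
    (π := (R₂.right : D →⋆ₙₐ[ℂ] (K₂ →L[ℂ] K₂))) (fun n M => (R₂.corner_isCI n M).le)
    ⟨R₂.corner_bimodule.map_left, R₂.corner_bimodule.map_right⟩

/-- The completely positive maps in the two directions preserve entries, so they invert each other;
each supplies one half of the order equivalence and one of the two norm inequalities. -/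
theorem exists_systemEquiv (R₁ : FaithfulCES C D μ H₁ K₁) (R₂ : FaithfulCES C D μ H₂ K₂) :
    ∃ e : R₁.system ≃ₗ[ℂ] R₂.system,
      (∀ (c : C) (x y : Xt) (d : D), e (R₁.elt c x y d) = R₂.elt c x y d) ∧
      IsOperatorSystemIso e := by
  obtain ⟨Ψ, hΨ, hΨp⟩ := R₁.exists_completelyPositive_mat R₂
  obtain ⟨Ψ', hΨ', hΨp'⟩ := R₂.exists_completelyPositive_mat R₁
  have hmem : ∀ s, Ψ s ∈ R₂.system := fun s => by
    obtain ⟨c, x, y, d, rfl⟩ := R₁.exists_elt s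
    rw [hΨ]
    exact ⟨c, x, y, d, rfl⟩
  have hmem' : ∀ s, Ψ' s ∈ R₁.system := fun s => by
    obtain ⟨c, x, y, d, rfl⟩ := R₂.exists_elt s
    rw [hΨ']
    exact ⟨c, x, y, d, rfl⟩
  have he : ∀ c x y d, Ψ.codRestrict R₂.system hmem (R₁.elt c x y d) = R₂.elt c x y d :=
    fun c x y d => Subtype.ext (hΨ c x y d)
  have he' : ∀ c x y d, Ψ'.codRestrict R₁.system hmem' (R₂.elt c x y d) = R₁.elt c x y d :=
    fun c x y d => Subtype.ext (hΨ' c x y d)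
  have hone : ∃ s : R₁.system, (s : WithLp 2 (H₁ × K₁) →L[ℂ] WithLp 2 (H₁ × K₁)) = 1 ∧ Ψ s = 1 :=
    ⟨R₁.elt 1 0 0 1, R₁.mat_one, by rw [hΨ, R₂.mat_one]⟩
  have hone' : ∃ s : R₂.system, (s : WithLp 2 (H₂ × K₂) →L[ℂ] WithLp 2 (H₂ × K₂)) = 1 ∧ Ψ' s = 1 :=
    ⟨R₂.elt 1 0 0 1, R₂.mat_one, by rw [hΨ', R₁.mat_one]⟩
  have hstar : ∀ s : R₁.system, ∃ t : R₁.system,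
      (t : WithLp 2 (H₁ × K₁) →L[ℂ] WithLp 2 (H₁ × K₁)) = star (s : WithLp 2 (H₁ × K₁) →L[ℂ] WithLp 2 (H₁ × K₁)) ∧
        Ψ t = star (Ψ s) := fun s => by
    obtain ⟨c, x, y, d, rfl⟩ := R₁.exists_elt s
    exact ⟨R₁.elt (star c) y x (star d), (R₁.star_mat c x y d).symm,
      by rw [hΨ, hΨ, R₂.star_mat]⟩
  have hstar' : ∀ s : R₂.system, ∃ t : R₂.system,
      (t : WithLp 2 (H₂ × K₂) →L[ℂ] WithLp 2 (H₂ × K₂)) = star (s : WithLp 2 (H₂ × K₂) →L[ℂ] WithLp 2 (H₂ × K₂)) ∧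
        Ψ' t = star (Ψ' s) := fun s => by
    obtain ⟨c, x, y, d, rfl⟩ := R₂.exists_elt s
    exact ⟨R₂.elt (star c) y x (star d), (R₂.star_mat c x y d).symm,
      by rw [hΨ', hΨ', R₁.star_mat]⟩
  let e : R₁.system ≃ₗ[ℂ] R₂.system :=
    LinearEquiv.ofLinearMap (Ψ.codRestrict R₂.system hmem) (Ψ'.codRestrict R₁.system hmem')
      (LinearMap.ext fun s => by
        obtain ⟨c, x, y, d, rfl⟩ := R₂.exists_elt s
        rw [LinearMap.comp_apply, he', he, LinearMap.id_apply])
      (LinearMap.ext fun s => by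
        obtain ⟨c, x, y, d, rfl⟩ := R₁.exists_elt s
        rw [LinearMap.comp_apply, he, he', LinearMap.id_apply])
  have hback : ∀ {n : ℕ} (M : Matrix (Fin n) (Fin n) R₁.system),
      (M.map e).map Ψ' = M.map Subtype.val := fun M => by
    ext1 i j
    exact congrArg Subtype.val (e.symm_apply_apply (M i j))
  refine ⟨e, he, ⟨fun s hs => ?_, fun s t hst => ?_, fun n M => ⟨fun h => ?_, hΨp n M⟩,
    fun n M => le_antisymm (hΨp.norm_matOp_le hone hstar M) ?_⟩⟩
  · obtain ⟨u, hu, hu'⟩ := hone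
    rw [Subtype.ext (hs.trans hu.symm)]
    exact hu'
  · obtain ⟨u, hu, hu'⟩ := hstar s
    rw [Subtype.ext (hst.trans hu.symm)]
    exact hu'
  · have := hΨp' n (M.map e) h
    rwa [hback] at this
  · have := hΨp'.norm_matOp_le hone' hstar' (M.map e)
    rwa [hback] at this

/-- Multiplicativity holds because the entries of a product are given in both representations by the
same formula in $\mathcal C$, $\mathcal D$ and $\tilde X$. -/
theorem exists_upperEquiv {X : Type*} (R₁ : FaithfulCES C D μ H₁ K₁)
    (R₂ : FaithfulCES C D μ H₂ K₂) (A : Subalgebra ℂ C) (B : Subalgebra ℂ D)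
    [AddCommGroup X] [Module ℂ X] [Module A X] [Module Bᵐᵒᵖ X] (i : X →ₗ[ℂ] Xt)
    (hi : IsBimoduleMap (Subtype.val : A → C) (Subtype.val : B → D) i)
    (e : R₁.system ≃ₗ[ℂ] R₂.system)
    (he : ∀ (c : C) (x y : Xt) (d : D), e (R₁.elt c x y d) = R₂.elt c x y d) :
    ∃ f : R₁.upper A B i hi ≃ₐ[ℂ] R₂.upper A B i hi,
      ∀ T : R₁.upper A B i hi, (f T : WithLp 2 (H₂ × K₂) →L[ℂ] WithLp 2 (H₂ × K₂)) =
        e ⟨T, R₁.upper_le_system A B i hi T.2⟩ := by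
  have he' : ∀ (c : C) (x y : Xt) (d : D), e.symm (R₂.elt c x y d) = R₁.elt c x y d :=
    fun c x y d => by rw [LinearEquiv.symm_apply_eq, he]
  let E : R₁.upper A B i hi → R₁.system := fun T => ⟨T, R₁.upper_le_system A B i hi T.2⟩
  let E' : R₂.upper A B i hi → R₂.system := fun T => ⟨T, R₂.upper_le_system A B i hi T.2⟩
  have hmem : ∀ T, (e (E T) : WithLp 2 (H₂ × K₂) →L[ℂ] WithLp 2 (H₂ × K₂)) ∈ R₂.upper A B i hi := by
    rintro ⟨_, a, x, b, rfl⟩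
    exact ⟨a, x, b, congrArg Subtype.val (he a (i x) 0 b)⟩
  have hmem' : ∀ T, (e.symm (E' T) : WithLp 2 (H₁ × K₁) →L[ℂ] WithLp 2 (H₁ × K₁)) ∈ R₁.upper A B i hi := by
    rintro ⟨_, a, x, b, rfl⟩
    exact ⟨a, x, b, congrArg Subtype.val (he' a (i x) 0 b)⟩
  have hmul : ∀ S T, (e (E (S * T)) : WithLp 2 (H₂ × K₂) →L[ℂ] WithLp 2 (H₂ × K₂)) = e (E S) * e (E T) := by
    rintro ⟨_, a, x, b, rfl⟩ ⟨_, a', x', b', rfl⟩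
    have h1 : (e (R₁.elt (a * a') ((a : C) • i x' + MulOpposite.op (b' : D) • i x) 0 (b * b')) :
        WithLp 2 (H₂ × K₂) →L[ℂ] WithLp 2 (H₂ × K₂)) =
        e (R₁.elt a (i x) 0 b) * e (R₁.elt a' (i x') 0 b') := by
      rw [he, he, he, coe_elt, coe_elt, coe_elt, mat_mul_mat_zero]
    have h2 : E (⟨_, a, x, b, rfl⟩ * ⟨_, a', x', b', rfl⟩) =
        R₁.elt (a * a') ((a : C) • i x' + MulOpposite.op (b' : D) • i x) 0 (b * b') :=
      Subtype.ext (R₁.mat_mul_mat_zero _ _ _ _ _ _)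
    exact (congrArg (fun s => (e s : WithLp 2 (H₂ × K₂) →L[ℂ] WithLp 2 (H₂ × K₂))) h2).trans h1
  have hone : (e (E 1) : WithLp 2 (H₂ × K₂) →L[ℂ] WithLp 2 (H₂ × K₂)) = 1 := by
    have : E 1 = R₁.elt 1 0 0 1 := Subtype.ext R₁.mat_one.symm
    rw [this, he, coe_elt, mat_one]
  let f : R₁.upper A B i hi ≃ₗ[ℂ] R₂.upper A B i hi :=
    { toFun := fun T => ⟨e (E T), hmem T⟩
      invFun := fun T => ⟨e.symm (E' T), hmem' T⟩
      map_add' := fun S T => by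
        have h := congrArg Subtype.val (map_add e (E S) (E T))
        exact Subtype.ext h
      map_smul' := fun r T => by
        have h := congrArg Subtype.val (map_smul e r (E T))
        exact Subtype.ext h
      left_inv := fun T => by
        have h := congrArg Subtype.val (e.symm_apply_apply (E T))
        exact Subtype.ext h
      right_inv := fun T => by
        have h := congrArg Subtype.val (e.apply_symm_apply (E' T))
        exact Subtype.ext h }
  exact ⟨AlgEquiv.ofLinearEquiv f (Subtype.ext hone) fun S T => Subtype.ext (hmul S T),
    fun T => rfl⟩

end FaithfulCES

end BiDil

theorem theorem6p1 {C D : Type u} [CStarAlgebra C] [CStarAlgebra D]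
    (A : Subalgebra ℂ C) (B : Subalgebra ℂ D)
    (_hA : BiDil.IsMaximalCStarAlgebra A) (_hB : BiDil.IsMaximalCStarAlgebra B)
    {X Xt : Type u} [AddCommGroup X] [Module ℂ X] [Module A X] [Module Bᵐᵒᵖ X]
    [AddCommGroup Xt] [Module ℂ Xt] [Module C Xt] [Module Dᵐᵒᵖ Xt]
    (ν : BiDil.MatNorm X) (μ : BiDil.MatNorm Xt) (i : X →ₗ[ℂ] Xt)
    (_hX : BiDil.IsOperatorBimodule (BiDil.subNorms A) (BiDil.subNorms B) ν)
    (hXt : BiDil.IsBiDilation A B ν μ i) :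
    (∀ (H' K' H K : Type*)
      [NormedAddCommGroup H'] [InnerProductSpace ℂ H'] [CompleteSpace H']
      [NormedAddCommGroup K'] [InnerProductSpace ℂ K'] [CompleteSpace K']
      [NormedAddCommGroup H] [InnerProductSpace ℂ H] [CompleteSpace H]
      [NormedAddCommGroup K] [InnerProductSpace ℂ K] [CompleteSpace K]
      (R : BiDil.FaithfulCES C D μ H' K')
      (θ : C →⋆ₙₐ[ℂ] (H →L[ℂ] H)) (π : D →⋆ₙₐ[ℂ] (K →L[ℂ] K)) (Φ : Xt →ₗ[ℂ] (K →L[ℂ] H)),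
      BiDil.IsCC μ (BiDil.opNorms K H) Φ → BiDil.IsOpBimoduleMap θ π Φ →
      ∃ Ψ : R.system →ₗ[ℂ] (WithLp 2 (H × K) →L[ℂ] WithLp 2 (H × K)),
        (∀ (c : C) (x y : Xt) (d : D),
          Ψ (R.elt c x y d) = BiDil.block (θ c) (Φ x) (Φ y).adjoint (π d)) ∧
        BiDil.IsCompletelyPositive Ψ) ∧
    (∀ (H₁ K₁ H₂ K₂ : Type*)
      [NormedAddCommGroup H₁] [InnerProductSpace ℂ H₁] [CompleteSpace H₁]
      [NormedAddCommGroup K₁] [InnerProductSpace ℂ K₁] [CompleteSpace K₁]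
      [NormedAddCommGroup H₂] [InnerProductSpace ℂ H₂] [CompleteSpace H₂]
      [NormedAddCommGroup K₂] [InnerProductSpace ℂ K₂] [CompleteSpace K₂]
      (R₁ : BiDil.FaithfulCES C D μ H₁ K₁) (R₂ : BiDil.FaithfulCES C D μ H₂ K₂),
      ∃ e : R₁.system ≃ₗ[ℂ] R₂.system,
        (∀ (c : C) (x y : Xt) (d : D), e (R₁.elt c x y d) = R₂.elt c x y d) ∧
        BiDil.IsOperatorSystemIso e ∧
        ∃ f : R₁.upper A B i hXt.isBimoduleMap ≃ₐ[ℂ] R₂.upper A B i hXt.isBimoduleMap,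
          (∀ T : R₁.upper A B i hXt.isBimoduleMap,
            (f T : WithLp 2 (H₂ × K₂) →L[ℂ] WithLp 2 (H₂ × K₂)) =
              e ⟨T, R₁.upper_le_system A B i hXt.isBimoduleMap T.2⟩) ∧
          BiDil.IsCI
            (BiDil.inheritedNorms (R₁.upper A B i hXt.isBimoduleMap :
              Set (WithLp 2 (H₁ × K₁) →L[ℂ] WithLp 2 (H₁ × K₁))))
            (BiDil.inheritedNorms (R₂.upper A B i hXt.isBimoduleMap :
              Set (WithLp 2 (H₂ × K₂) →L[ℂ] WithLp 2 (H₂ × K₂)))) f) := by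
  refine ⟨?_, ?_⟩
  · intro H' K' H K _ _ _ _ _ _ _ _ _ _ _ _ R θ π Φ hΦ hbi
    exact R.exists_completelyPositive hΦ hbi
  · intro H₁ K₁ H₂ K₂ _ _ _ _ _ _ _ _ _ _ _ _ R₁ R₂
    obtain ⟨e, he, hiso⟩ := R₁.exists_systemEquiv R₂
    obtain ⟨f, hf⟩ := R₁.exists_upperEquiv R₂ A B i hXt.isBimoduleMap e he
    refine ⟨e, he, hiso, f, hf, fun n M => ?_⟩
    -- The upper algebras inherit their norms from the same operators as the systems, so complete
    -- isometry restricts.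
    have h1 := hiso.isCI n
      (M.map fun T => ⟨T, R₁.upper_le_system A B i hXt.isBimoduleMap T.2⟩)
    have h2 : (M.map f).map (Subtype.val : R₂.upper A B i hXt.isBimoduleMap → _) =
        (M.map fun T => (e ⟨T, R₁.upper_le_system A B i hXt.isBimoduleMap T.2⟩ :
          WithLp 2 (H₂ × K₂) →L[ℂ] WithLp 2 (H₂ × K₂))) := by
      ext1 k l
      exact hf (M k l)
    exact (congrArg (fun N => ‖BiDil.matOp N‖) h2).trans h1
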